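/- Let $K$ be a field, $N, M\ge 0$ integers, and for $i=1,\dots,N$ let $a_1^{(i)},a_2^{(i)},b_1^{(i)},b_2^{(i)},c_1^{(i)},c_2^{(i)}\in K$ satisfy the free fermion condition $a_1^{(i)}a_2^{(i)}+b_1^{(i)}b_2^{(i)}=c_1^{(i)}c_2^{(i)}$ and $a_1^{(i)}\neq 0$. Consider the six-vertex model on a grid with $N$ rows, numbered $1,\dots,N$ from bottom to top, and $M+1$ columns, numbered $0,\dots,M$ from left to right. Edges carry spins $\pm$. A vertex in row $i$ whose spins on the (left, top, right, bottom) edges are $(+,+,+,+)$, $(-,-,-,-)$, $(+,-,+,-)$, $(-,+,-,+)$, $(-,+,+,-)$, $(+,-,-,+)$ has weight $a_1^{(i)},a_2^{(i)},b_1^{(i)},b_2^{(i)},c_1^{(i)},c_2^{(i)}$ respectively; every other vertex has weight $0$. The weight of a state (an assignment of spins to all edges) is the product of the weights of its vertices. Let $\lambda=(\lambda_1\ge\dots\ge\lambda_N\ge 0)$ be a partition such that all parts of the strict partition $\lambda+\rho=(\lambda_1+N-1,\lambda_2+N-2,\dots,\lambda_N)$ are at most $M$. Let $Z_\lambda$ be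 the sum of the weights of all states with domain-wall boundary conditions: all right boundary edges are $-$, all left and all bottom boundary edges are $+$, and the top boundary edge in column $j$ is $-$ if $j$ is a part of $\lambda+\rho$ and $+$ otherwise. Let $\tau$ be the complement of $\lambda$ in an $N\times(M+1-N)$ box, rotated by $180^\circ$, i.e. $\tau_k=M+1-N-\lambda_{N+1-k}$ for $1\le k\le N$. Then $$Z_\lambda=\prod_{i=1}^N (a_1^{(i)})^{M+1-N}c_2^{(i)}\cdot\prod_{1\le j<i\le N}\left(a_1^{(j)}a_2^{(i)}+b_1^{(i)}b_2^{(j)}\right)\cdot s_\tau\!\left[\frac{b_2^{(1)}}{a_1^{(1)}},\dots,\frac{b_2^{(N)}}{a_1^{(N)}}\right],$$ where $s_\tau[x_1,\dots,x_N]$ is the Schur polynomial, i.e. the polynomial $\det\big(x_i^{\tau_j+N-j}\big)_{i,j}\big/\det\big(x_i^{N-j}\big)_{i,j}$. -/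

import Mathlib

/-- The two spins on an edge: `minus` marks a particle, `plus` its absence. -/
inductive Spin : Type
  | plus : Spin
  | minus : Spin
deriving DecidableEq

instance : Fintype Spin where
  elems := {.plus, .minus}
  complete := by intro s; cases s <;> simp

/-- The Boltzmann weights of the six admissible vertices of one row. -/
structure SixVertexWeights (K : Type*) where
  a₁ : K
  a₂ : K
  b₁ : K
  b₂ : K
  c₁ : K
  c₂ : K

namespace SixVertexWeights

/-- The free fermion condition. -/
def FreeFermionic {K : Type*} [CommRing K] (w : SixVertexWeights K) : Prop :=
  w.a₁ * w.a₂ + w.b₁ * w.b₂ = w.c₁ * w.c₂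

/-- The weight of a vertex, given the spins on its left, top, right and bottom edges.
Following the `minus` spins, paths move up and left. Non-admissible vertices have weight `0`. -/
def vertexWeight {K : Type*} [CommRing K] (w : SixVertexWeights K) :
    (left top right bottom : Spin) → K
  | .plus, .plus, .plus, .plus => w.a₁
  | .minus, .minus, .minus, .minus => w.a₂
  | .plus, .minus, .plus, .minus => w.b₁
  | .minus, .plus, .minus, .plus => w.b₂
  | .minus, .plus, .plus, .minus => w.c₁
  | .plus, .minus, .minus, .plus => w.c₂
  | _, _, _, _ => 0

end SixVertexWeights

/-- An assignment of spins to all the edges of a grid with `N` rows (numbered from bottom to top)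
and `C` columns (numbered from left to right). The edge `hor i j` is in row `i`, immediately to the
left of column `j` (or right of the last column, for `j = C`); the edge `ver i j` is in column `j`,
immediately below row `i` (or above the last row, for `i = N`). -/
abbrev LatticeState (N C : ℕ) : Type :=
  (Fin N → Fin (C + 1) → Spin) × (Fin (N + 1) → Fin C → Spin)

namespace LatticeState

variable {N C : ℕ}

/-- The spin on a horizontal edge. -/
def hor (s : LatticeState N C) (i : Fin N) (j : Fin (C + 1)) : Spin := s.1 i j

/-- The spin on a vertical edge. -/
def ver (s : LatticeState N C) (i : Fin (N + 1)) (j : Fin C) : Spin := s.2 i j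

/-- The state `s` has the prescribed spins on the boundary edges. -/
def HasBoundary (s : LatticeState N C) (left right : Fin N → Spin) (bottom top : Fin C → Spin) :
    Prop :=
  (∀ i, s.hor i 0 = left i) ∧ (∀ i, s.hor i (Fin.last C) = right i) ∧
    (∀ j, s.ver 0 j = bottom j) ∧ (∀ j, s.ver (Fin.last N) j = top j)

/-- The Boltzmann weight of a state: the product of the weights of its vertices. -/
def weight {K : Type*} [CommRing K] (w : Fin N → SixVertexWeights K) (s : LatticeState N C) : K :=
  ∏ i : Fin N, ∏ j : Fin C,
    (w i).vertexWeight (s.hor i j.castSucc) (s.ver i.succ j) (s.hor i j.succ) (s.ver i.castSucc j)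

end LatticeState

open Classical in
/-- The partition function of the six-vertex model with row weights `w` and prescribed boundary
spins: the sum of the weights of all states (non-admissible states have weight `0`). -/
noncomputable def partitionFunction {K : Type*} [CommRing K] {N C : ℕ}
    (w : Fin N → SixVertexWeights K) (left right : Fin N → Spin) (bottom top : Fin C → Spin) : K :=
  ∑ s : LatticeState N C with s.HasBoundary left right bottom top, s.weight w

/-- The shift `lam + ρ`, where `ρ = (N - 1, …, 1, 0)`. -/
def shiftRho {N : ℕ} (lam : Fin N → ℕ) (k : Fin N) : ℕ := lam k + (k.rev : ℕ)

open Classical in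
/-- Boundary spins that are `minus` exactly in the columns (numbered from `0`) that are parts of the
strict partition `p`. -/
noncomputable def boundarySpin {N C : ℕ} (p : Fin N → ℕ) (j : Fin C) : Spin :=
  if ∃ k, p k = (j : ℕ) then .minus else .plus

/-- The partition function `Z_lam` with domain-wall boundary conditions: columns `0, …, M`, right
edges `minus`, left and bottom edges `plus`, top edges `minus` on the parts of `lam + ρ`. -/
noncomputable def domainWallZ {K : Type*} [CommRing K] {N : ℕ} (M : ℕ)
    (w : Fin N → SixVertexWeights K) (lam : Fin N → ℕ) : K :=
  partitionFunction (C := M + 1) w (fun _ => .plus) (fun _ => .minus) (fun _ => .plus)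
    (boundarySpin (shiftRho lam))

/-- The complement of `lam` in a box with `N` rows of length `L`, rotated by 180 degrees. -/
def boxComplement {N : ℕ} (L : ℕ) (lam : Fin N → ℕ) (k : Fin N) : ℕ := L - lam k.rev

/-- The alternant `det (X_i ^ m_j)`. -/
noncomputable def alternant {N : ℕ} (m : Fin N → ℕ) : MvPolynomial (Fin N) ℤ :=
  (Matrix.of fun i j : Fin N => (MvPolynomial.X i : MvPolynomial (Fin N) ℤ) ^ m j).det

/-- The alternant of `ρ` divides every alternant. -/
theorem alternant_dvd {N : ℕ} (m : Fin N → ℕ) :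
    alternant (shiftRho fun _ : Fin N => 0) ∣ alternant m := by
  classical
  set P : Polynomial (MvPolynomial (Fin N) ℤ) :=
    ∏ i : Fin N, (Polynomial.X - Polynomial.C (MvPolynomial.X i)) with hP
  have hmon : P.Monic := Polynomial.monic_prod_of_monic _ _ fun i _ => Polynomial.monic_X_sub_C _
  have hroot : ∀ i : Fin N, P.eval (MvPolynomial.X i) = 0 := by
    intro i
    rw [hP, Polynomial.eval_prod]
    exact Finset.prod_eq_zero (Finset.mem_univ i) (by simp)
  have hdeg : P.natDegree = N := by
    rw [hP, Polynomial.natDegree_prod_of_monic _ _ fun i _ => Polynomial.monic_X_sub_C _]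
    simp
  have hlt : ∀ (_ : Fin N) (k : ℕ), (Polynomial.X ^ k %ₘ P).natDegree < N := by
    intro i k
    have h1 : P ≠ 1 := by
      intro h
      have := i.pos
      rw [h, Polynomial.natDegree_one] at hdeg
      omega
    have h := Polynomial.natDegree_modByMonic_lt (Polynomial.X ^ k) hmon h1
    rwa [hdeg] at h
  have key : (Matrix.of fun i j : Fin N => (MvPolynomial.X i : MvPolynomial (Fin N) ℤ) ^ m j) =
      (Matrix.of fun i j : Fin N =>
        (MvPolynomial.X i : MvPolynomial (Fin N) ℤ) ^ shiftRho (fun _ : Fin N => 0) j) *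
      (Matrix.of fun l j : Fin N => (Polynomial.X ^ m j %ₘ P).coeff (l.rev : ℕ)) := by
    ext1 i j
    have h1 : (Polynomial.X ^ m j %ₘ P).eval (MvPolynomial.X i) =
        (MvPolynomial.X i : MvPolynomial (Fin N) ℤ) ^ m j := by
      have h := congrArg (Polynomial.eval (MvPolynomial.X i))
        (Polynomial.modByMonic_add_div (Polynomial.X ^ m j) P)
      simpa [hroot i] using h
    rw [Matrix.mul_apply, Matrix.of_apply, ← h1,
      Polynomial.eval_eq_sum_range' (hlt i _),
      ← Fin.sum_univ_eq_sum_range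
        (fun l => (Polynomial.X ^ m j %ₘ P).coeff l * (MvPolynomial.X i) ^ l) N,
      ← Equiv.sum_comp Fin.revPerm]
    refine Finset.sum_congr rfl fun l _ => ?_
    simp [shiftRho, mul_comm]
  unfold alternant
  rw [key, Matrix.det_mul]
  exact dvd_mul_right _ _

/-- The Schur polynomial `s_tau = A_{tau + ρ} / A_ρ` in `N` variables. -/
noncomputable def schurPoly {N : ℕ} (tau : Fin N → ℕ) : MvPolynomial (Fin N) ℤ :=
  (alternant_dvd (shiftRho tau)).choose

theorem alternant_rho_mul_schurPoly {N : ℕ} (tau : Fin N → ℕ) :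
    alternant (shiftRho fun _ : Fin N => 0) * schurPoly tau = alternant (shiftRho tau) :=
  (alternant_dvd (shiftRho tau)).choose_spec.symm

/-! Encode column `j` of `C` as the power `X ^ (C - 1 - j)` and the `minus` spins on a line of
vertical edges as the wedge product of their powers. With left spin `plus`, a row removes one
particle. Put x = b₂ / a₁. By the free fermion condition, summing over a row is, up to scalars,
contraction with evaluation at x: the two agree after every vector below the row is multiplied by
a₁X - b₂ and every vector of the contraction by a₂ + b₁X (`map_rowState`).

Evaluation at a point turns multiplication by a polynomial into a scalar (`evalAlternant_map`). So
when rows are peeled off from the top, row i contributes the factors a₁(x_j - x_i) on one side and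
a₂ + b₁x_j on the other, for j < i. The N contractions together form a determinant of values
(`evalAlternant_ιMulti`), here the alternant of τ + ρ. Thus Z times the Vandermonde product is an
explicit product times that alternant (`partitionFunction_mul_prod_sub`).

The Vandermonde product may vanish over K. The weights are therefore deformed over a polynomial
ring, where the points are distinct and it cancels, and the deformation is then set to 0. -/

namespace ExteriorAlgebra

/-! ### Contractions of the exterior algebra -/

variable {R V : Type*} [CommRing R] [AddCommGroup V] [Module R V]

/-- The grading involution of the exterior algebra. -/
noncomputable def gradeInvolution : ExteriorAlgebra R V →ₐ[R] ExteriorAlgebra R V :=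
  CliffordAlgebra.involute

theorem gradeInvolution_ι (v : V) : gradeInvolution (ι R v) = -ι R v :=
  CliffordAlgebra.involute_ι v

/-- Contraction with a functional, followed by the grading involution. On a product of vectors it
contracts the last vector with sign `+`. -/
noncomputable def lastContraction (d : Module.Dual R V) :
    ExteriorAlgebra R V →ₗ[R] ExteriorAlgebra R V :=
  (gradeInvolution (R := R) (V := V)).toLinearMap ∘ₗ
    CliffordAlgebra.contractLeft (Q := (0 : QuadraticForm R V)) d

theorem lastContraction_algebraMap (d : Module.Dual R V) (r : R) :
    lastContraction d (algebraMap R (ExteriorAlgebra R V) r) = 0 := by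
  change gradeInvolution (CliffordAlgebra.contractLeft (Q := (0 : QuadraticForm R V)) d
    (algebraMap R (CliffordAlgebra (0 : QuadraticForm R V)) r)) = 0
  rw [CliffordAlgebra.contractLeft_algebraMap, map_zero]

theorem lastContraction_one (d : Module.Dual R V) :
    lastContraction d (1 : ExteriorAlgebra R V) = 0 := by
  simpa using lastContraction_algebraMap d 1

/-- The sign of the left contraction cancels against that of the involution, so a vector prepended
on the left passes through without sign. This suits an induction that adds columns on the left. -/
theorem lastContraction_ι_mul (d : Module.Dual R V) (v : V) (y : ExteriorAlgebra R V) :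
    lastContraction d (ι R v * y) = d v • gradeInvolution y + ι R v * lastContraction d y := by
  change gradeInvolution (CliffordAlgebra.contractLeft (Q := (0 : QuadraticForm R V)) d
    (CliffordAlgebra.ι _ v * y)) = _
  rw [CliffordAlgebra.contractLeft_ι_mul, map_sub, map_smul, map_mul, sub_eq_add_neg]
  congr 1
  change -(gradeInvolution (ι R v) * _) = _
  rw [gradeInvolution_ι, neg_mul, neg_neg]
  rfl

/-- Induction on products of vectors. -/
theorem ι_mul_induction {p : ExteriorAlgebra R V → Prop}
    (algebraMap : ∀ r, p (algebraMap R _ r)) (add : ∀ y z, p y → p z → p (y + z))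
    (ι_mul : ∀ y v, p y → p (ι R v * y)) (y : ExteriorAlgebra R V) : p y :=
  CliffordAlgebra.left_induction (Q := (0 : QuadraticForm R V)) algebraMap add
    (fun y v h => ι_mul y v h) y

theorem gradeInvolution_map (f : V →ₗ[R] V) (y : ExteriorAlgebra R V) :
    gradeInvolution (map f y) = map f (gradeInvolution y) := by
  induction y using ι_mul_induction with
  | algebraMap r => simp
  | add y z hy hz => simp [hy, hz]
  | ι_mul y v hy => simp [hy, gradeInvolution_ι]

theorem lastContraction_map (d : Module.Dual R V) (f : V →ₗ[R] V) (y : ExteriorAlgebra R V) :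
    lastContraction d (map f y) = map f (lastContraction (d ∘ₗ f) y) := by
  induction y using ι_mul_induction with
  | algebraMap r => simp [lastContraction_algebraMap]
  | add y z hy hz => simp [hy, hz]
  | ι_mul y v hy => simp [hy, lastContraction_ι_mul, gradeInvolution_map]

theorem lastContraction_smul (r : R) (d : Module.Dual R V) (y : ExteriorAlgebra R V) :
    lastContraction (r • d) y = r • lastContraction d y := by
  simp [lastContraction]

theorem lastContraction_ιMulti (d : Module.Dual R V) (n : ℕ) (v : Fin (n + 1) → V) :
    lastContraction d (ιMulti R (n + 1) v) =
      ∑ j : Fin (n + 1), ((-1) ^ (n + (j : ℕ)) * d (v j)) • ιMulti R n (v ∘ j.succAbove) := by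
  induction n with
  | zero =>
    have h := lastContraction_ι_mul d (v 0) 1
    rw [mul_one, lastContraction_one, map_one, mul_zero, add_zero] at h
    simpa [ιMulti_succ_apply, Algebra.smul_def] using h
  | succ n ih =>
    have hgr : ∀ (m : ℕ) (u : Fin m → V),
        gradeInvolution (ιMulti R m u) = (-1 : R) ^ m • ιMulti R m u := by
      intro m
      induction m with
      | zero => simp
      | succ m ihm =>
        intro u
        rw [ιMulti_succ_apply, map_mul, ihm, gradeInvolution_ι, pow_succ]
        simp
    rw [ιMulti_succ_apply, lastContraction_ι_mul, ih, Fin.sum_univ_succ (n := n + 1), hgr, smul_smul,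
      Finset.mul_sum]
    congr 1
    · rw [mul_comm]; rfl
    · refine Finset.sum_congr rfl fun j _ => ?_
      rw [ιMulti_succ_apply, mul_smul_comm]
      have h1 : (v ∘ j.succ.succAbove) 0 = v 0 := by simp
      have h2 : Matrix.vecTail (v ∘ j.succ.succAbove) = Matrix.vecTail v ∘ j.succAbove := by
        ext k; simp [Matrix.vecTail]
      rw [h1, h2]
      congr 1
      simp only [Matrix.vecTail, Fin.val_succ, Function.comp]
      ring

/-! ### Iterated contraction with evaluations at points -/

open Polynomial

/-- The functional that sends a wedge product of `n` polynomials to the determinant of their values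
at the given points (see `evalAlternant_ιMulti`) and vanishes in all degrees other than `n`. -/
noncomputable def evalAlternant : (n : ℕ) → (Fin n → R) → ExteriorAlgebra R R[X] →ₗ[R] R
  | 0, _ => algebraMapInv.toLinearMap
  | n + 1, x => evalAlternant n (Fin.init x) ∘ₗ lastContraction (leval (x (Fin.last n)))

theorem evalAlternant_succ (n : ℕ) (x : Fin (n + 1) → R) (y : ExteriorAlgebra R R[X]) :
    evalAlternant (n + 1) x y =
      evalAlternant n (Fin.init x) (lastContraction (leval (x (Fin.last n))) y) := rfl

/-- Evaluation at a point is an eigenvector of the transpose of multiplication by `f`, with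
eigenvalue the value of `f` there. -/
theorem evalAlternant_map (n : ℕ) (x : Fin n → R) (f : R[X]) (y : ExteriorAlgebra R R[X]) :
    evalAlternant n x (map (LinearMap.mulLeft R f) y) =
      (∏ i, f.eval (x i)) * evalAlternant n x y := by
  induction n generalizing y with
  | zero =>
    have : algebraMapInv.comp (map (LinearMap.mulLeft R f)) =
        (algebraMapInv : ExteriorAlgebra R R[X] →ₐ[R] R) := by
      ext; simp [algebraMapInv]
    simpa [evalAlternant] using DFunLike.congr_fun this y
  | succ n ih =>
    have : leval (x (Fin.last n)) ∘ₗ LinearMap.mulLeft R f =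
        f.eval (x (Fin.last n)) • leval (x (Fin.last n)) := by
      ext; simp
    rw [evalAlternant_succ, lastContraction_map, ih, this, lastContraction_smul, map_smul,
      ← evalAlternant_succ, Fin.prod_univ_castSucc, smul_eq_mul, mul_assoc]
    rfl

/-- Each contraction is the Laplace expansion along the last row. -/
theorem evalAlternant_ιMulti (n : ℕ) (x : Fin n → R) (v : Fin n → R[X]) :
    evalAlternant n x (ιMulti R n v) = (Matrix.of fun i j => (v j).eval (x i)).det := by
  induction n with
  | zero => simp [evalAlternant]
  | succ n ih =>
    rw [evalAlternant_succ, lastContraction_ιMulti, map_sum, Matrix.det_succ_row _ (Fin.last n)]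
    refine Finset.sum_congr rfl fun j _ => ?_
    rw [map_smul, ih, smul_eq_mul]
    congr 1
    congr 1
    ext i k
    simp [Fin.init]

end ExteriorAlgebra

/-! ### A single row as a contraction -/

section FreeFermions

open ExteriorAlgebra Polynomial

theorem Spin.sum_univ {A : Type*} [AddCommMonoid A] (f : Spin → A) :
    ∑ s, f s = f .plus + f .minus :=
  Finset.sum_pair (by decide)

variable {R : Type*} [CommRing R]

/-- The exterior product of the powers of `X` given by the columns with spin `minus`; the exponent
of a column is its distance to the last column. -/
noncomputable def spinWedge (R : Type*) [CommRing R] {C : ℕ} (v : Fin C → Spin) :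
    ExteriorAlgebra R R[X] :=
  (List.ofFn fun j => if v j = .minus then ι R (X ^ (j.rev : ℕ) : R[X]) else 1).prod

theorem spinWedge_cons {C : ℕ} (s : Spin) (v : Fin C → Spin) :
    spinWedge R (Fin.cons s v : Fin (C + 1) → Spin) =
      (if s = .minus then ι R (X ^ C : R[X]) else 1) * spinWedge R v := by
  simp [spinWedge, List.ofFn_succ]

/-- The partition function of a single row with right boundary spin `minus`. -/
noncomputable def rowTransfer {C : ℕ} (w : SixVertexWeights R) (left : Spin)
    (top bottom : Fin C → Spin) : R :=
  ∑ h : Fin (C + 1) → Spin, if h 0 = left ∧ h (Fin.last C) = .minus then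
    ∏ j : Fin C, w.vertexWeight (h j.castSucc) (top j) (h j.succ) (bottom j) else 0

/-- Without columns the left edge is the right boundary edge, whose spin is `minus`. -/
theorem rowTransfer_zero (w : SixVertexWeights R) (left : Spin) (top bottom : Fin 0 → Spin) :
    rowTransfer w left top bottom = if left = .minus then 1 else 0 := by
  rw [rowTransfer, ← (Equiv.funUnique (Fin 1) Spin).symm.sum_comp, Spin.sum_univ]
  cases left <;> simp

theorem rowTransfer_cons {C : ℕ} (w : SixVertexWeights R) (left s t : Spin)
    (top bottom : Fin C → Spin) :
    rowTransfer w left (Fin.cons s top : Fin (C + 1) → Spin) (Fin.cons t bottom) =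
      ∑ r, w.vertexWeight left s r t * rowTransfer w r top bottom := by
  rw [rowTransfer, ← (Fin.consEquiv fun _ : Fin (C + 2) => Spin).sum_comp, Fintype.sum_prod_type,
    Finset.sum_eq_single left (by
      intro r _ hr
      exact Finset.sum_eq_zero fun h _ => if_neg fun h' => hr (by simpa using h'.1)) (by simp)]
  simp only [rowTransfer, Finset.mul_sum]
  rw [Finset.sum_comm]
  refine Finset.sum_congr rfl fun h _ => ?_
  rw [Finset.sum_eq_single (h 0) (by intro r _ hr; simp [hr.symm]) (by simp)]
  simp [Fin.prod_univ_succ, Fin.consEquiv, ← Fin.succ_last]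

/-- The state produced below a row by the configuration of spins above it. -/
noncomputable def rowState {C : ℕ} (w : SixVertexWeights R) (left : Spin) (top : Fin C → Spin) :
    ExteriorAlgebra R R[X] :=
  ∑ v : Fin C → Spin, rowTransfer w left top v • spinWedge R v

theorem rowState_cons {C : ℕ} (w : SixVertexWeights R) (left s : Spin) (top : Fin C → Spin) :
    rowState w left (Fin.cons s top : Fin (C + 1) → Spin) =
      ∑ r, (w.vertexWeight left s r .plus • rowState w r top +
        w.vertexWeight left s r .minus • (ι R (X ^ C : R[X]) * rowState w r top)) := by
  rw [rowState, ← (Fin.consEquiv fun _ : Fin (C + 1) => Spin).sum_comp, Fintype.sum_prod_type,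
    Spin.sum_univ]
  simp only [Fin.consEquiv, Equiv.coe_fn_mk, rowTransfer_cons, spinWedge_cons, Spin.sum_univ,
    rowState, Finset.smul_sum, Finset.mul_sum, ← Finset.sum_add_distrib]
  refine Finset.sum_congr rfl fun v _ => ?_
  simp only [reduceCtorEq, if_false, if_true, one_mul, mul_smul_comm, smul_smul, add_smul]
  abel

section RowState

variable (w : SixVertexWeights R)

/-- The row state with left spin `minus`, completed by the contribution of a path that goes straight
up in the next column. -/
noncomputable def completedRowState {C : ℕ} (top : Fin C → Spin) : ExteriorAlgebra R R[X] :=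
  w.c₂ • rowState w .minus top + w.b₁ • (ι R (X ^ C : R[X]) * rowState w .plus top)

theorem rowState_plus_nil (top : Fin 0 → Spin) : rowState w .plus top = 0 := by
  simp [rowState, rowTransfer_zero]

theorem rowState_minus_nil (top : Fin 0 → Spin) : rowState w .minus top = 1 := by
  simp [rowState, rowTransfer_zero, spinWedge]

section

variable {C : ℕ} (top : Fin C → Spin)

theorem rowState_plus_cons_plus :
    rowState w .plus (Fin.cons .plus top : Fin (C + 1) → Spin) = w.a₁ • rowState w .plus top := by
  simp [rowState_cons, Spin.sum_univ, SixVertexWeights.vertexWeight]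

theorem rowState_minus_cons_plus :
    rowState w .minus (Fin.cons .plus top : Fin (C + 1) → Spin) =
      w.c₁ • (ι R (X ^ C : R[X]) * rowState w .plus top) + w.b₂ • rowState w .minus top := by
  simp [rowState_cons, Spin.sum_univ, SixVertexWeights.vertexWeight]

theorem rowState_plus_cons_minus :
    rowState w .plus (Fin.cons .minus top : Fin (C + 1) → Spin) = completedRowState w top := by
  simp [rowState_cons, Spin.sum_univ, SixVertexWeights.vertexWeight, completedRowState, add_comm]

theorem rowState_minus_cons_minus :
    rowState w .minus (Fin.cons .minus top : Fin (C + 1) → Spin) =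
      w.a₂ • (ι R (X ^ C : R[X]) * rowState w .minus top) := by
  simp [rowState_cons, Spin.sum_univ, SixVertexWeights.vertexWeight]

theorem ι_smul_add_smul_X_mul (a b : R) (f : R[X]) :
    ι R ((Polynomial.C a + Polynomial.C b * X) * f) = a • ι R f + b • ι R (f * X) := by
  rw [← map_smul, ← map_smul, ← map_add]
  congr 1
  simp only [smul_eq_C_mul]
  ring

/-- The only use of the free fermion condition in the row recursion: c₁c₂ = a₁a₂ + b₁b₂ splits the
coefficient of X^C so that one part rebuilds the completed state and the other joins b₁X^(C+1) to
form (a₂ + b₁X)X^C. -/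
theorem completedRowState_cons_plus (hff : w.FreeFermionic) :
    completedRowState w (Fin.cons .plus top : Fin (C + 1) → Spin) =
      w.b₂ • completedRowState w top +
        w.a₁ • (ι R ((Polynomial.C w.a₂ + Polynomial.C w.b₁ * X) * X ^ C) *
          rowState w .plus top) := by
  rw [completedRowState, rowState_minus_cons_plus, rowState_plus_cons_plus, completedRowState,
    ι_smul_add_smul_X_mul, pow_succ]
  have h : w.c₂ * w.c₁ = w.a₁ * w.a₂ + w.b₂ * w.b₁ := by
    rw [mul_comm, ← hff, mul_comm w.b₁]
  simp only [smul_add, add_mul, smul_mul_assoc, mul_smul_comm, smul_smul, h, add_smul,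
    mul_comm w.b₁ w.a₁, mul_comm w.c₂ w.b₂]
  abel

/-- The missing term a₂b₁ X^C ∧ X^C is zero, so this case needs no relation among the weights. -/
theorem completedRowState_cons_minus :
    completedRowState w (Fin.cons .minus top : Fin (C + 1) → Spin) =
      ι R ((Polynomial.C w.a₂ + Polynomial.C w.b₁ * X) * X ^ C) * completedRowState w top := by
  have h : ι R (X ^ C : R[X]) * completedRowState w top =
      w.c₂ • (ι R (X ^ C : R[X]) * rowState w .minus top) := by
    rw [completedRowState, mul_add, mul_smul_comm, mul_smul_comm, ← mul_assoc, ι_sq_zero, zero_mul,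
      smul_zero, add_zero]
  rw [ι_smul_add_smul_X_mul, add_mul, smul_mul_assoc, h, completedRowState,
    rowState_minus_cons_minus, rowState_plus_cons_minus, pow_succ, smul_comm, smul_mul_assoc]

theorem spinWedge_cons_plus :
    spinWedge R (Fin.cons .plus top : Fin (C + 1) → Spin) = spinWedge R top := by
  simp [spinWedge_cons]

theorem spinWedge_cons_minus :
    spinWedge R (Fin.cons .minus top : Fin (C + 1) → Spin) =
      ι R (X ^ C : R[X]) * spinWedge R top := by
  simp [spinWedge_cons]

end

/-- The row states are, up to diagonal operators and scalars, contractions of the wedge product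
given by the spins above the row. -/
theorem map_rowState (hff : w.FreeFermionic) (x : R) (hx : w.b₂ = w.a₁ * x) {C : ℕ}
    (top : Fin C → Spin) :
    (w.a₁ • map (LinearMap.mulLeft R (Polynomial.C w.a₁ * X - Polynomial.C w.b₂))
        (rowState w .plus top) =
      (w.a₁ ^ C * w.c₂) • map (LinearMap.mulLeft R (Polynomial.C w.a₂ + Polynomial.C w.b₁ * X))
        (lastContraction (leval x) (spinWedge R top))) ∧
    (map (LinearMap.mulLeft R (Polynomial.C w.a₁ * X - Polynomial.C w.b₂))
        (completedRowState w top) =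
      (w.a₁ ^ C * w.c₂) • map (LinearMap.mulLeft R (Polynomial.C w.a₂ + Polynomial.C w.b₁ * X))
        (ι R (X ^ C : R[X]) * lastContraction (leval x) (spinWedge R top) +
          x ^ C • gradeInvolution (spinWedge R top))) := by
  induction C with
  -- Both identities are proved together by adding columns on the left. The second is the first for
  -- a `minus` column prepended to `top`, with one factor a₁ cancelled, which closes the recursion.
  | zero =>
    simp [completedRowState, rowState_plus_nil, rowState_minus_nil, spinWedge, lastContraction_one]
  | succ C ih =>
    obtain ⟨s, top, rfl⟩ : ∃ s t, top = Fin.cons s t := ⟨top 0, Fin.tail top, by simp⟩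
    obtain ⟨h1, h2⟩ := ih top
    set D := map (LinearMap.mulLeft R (Polynomial.C w.a₁ * X - Polynomial.C w.b₂))
    set F := map (LinearMap.mulLeft R (Polynomial.C w.a₂ + Polynomial.C w.b₁ * X))
    -- Since b₂ = a₁x, the multiplier a₁X - b₂ sends X^C to a₁(X^(C+1) - xX^C); in the `plus` case
    -- the term with x telescopes.
    have hDF : D (ι R ((Polynomial.C w.a₂ + Polynomial.C w.b₁ * X) * X ^ C)) =
        w.a₁ • F (ι R (X ^ (C + 1) : R[X]) - x • ι R (X ^ C : R[X])) := by
      rw [← map_smul (ι R), ← map_sub, map_apply_ι, map_apply_ι, ← map_smul (ι R)]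
      congr 1
      simp only [LinearMap.mulLeft_apply, smul_eq_C_mul, hx, map_mul, pow_succ]
      ring
    cases s with
    | plus =>
      rw [rowState_plus_cons_plus, completedRowState_cons_plus w top hff, spinWedge_cons_plus]
      constructor
      · rw [map_smul, h1, smul_smul, pow_succ']
        congr 1
        ring
      · rw [map_add, map_smul, map_smul, map_mul, h2, hDF, smul_mul_assoc, ← mul_smul_comm, h1, hx]
        simp only [map_add, map_sub, map_mul, map_smul, sub_mul, smul_add, smul_sub,
          smul_mul_assoc, mul_smul_comm, smul_smul]
        ring_nf
        abel
    | minus =>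
      have hB : lastContraction (leval x) (ι R (X ^ C : R[X]) * spinWedge R top) =
          ι R (X ^ C : R[X]) * lastContraction (leval x) (spinWedge R top) +
          x ^ C • gradeInvolution (spinWedge R top) := by
        rw [lastContraction_ι_mul, add_comm]
        simp
      rw [rowState_plus_cons_minus, completedRowState_cons_minus, spinWedge_cons_minus, hB]
      constructor
      · rw [h2, smul_smul]
        congr 1
        ring
      · rw [map_mul D, h2, hDF, smul_mul_assoc, mul_smul_comm, smul_smul, ← map_mul]
        congr 1
        · ring
        · congr 1
          have h0 : ι R (X ^ C : R[X]) *
              (ι R (X ^ C : R[X]) * lastContraction (leval x) (spinWedge R top)) = 0 := by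
            rw [← mul_assoc, ι_sq_zero, zero_mul]
          rw [map_mul, gradeInvolution_ι, sub_mul, sub_eq_add_neg]
          congr 1
          rw [smul_mul_assoc, mul_add, h0, zero_add, mul_smul_comm, smul_smul, ← pow_succ',
            neg_mul, smul_neg]

end RowState

/-! ### Stacking rows -/

namespace LatticeState

variable {N C : ℕ}

/-- Add a row on top of a state. -/
def addRow (s : LatticeState N C) (h : Fin (C + 1) → Spin) (top : Fin C → Spin) :
    LatticeState (N + 1) C :=
  (Fin.snoc s.1 h, Fin.snoc s.2 top)

theorem addRow_bijective :
    Function.Bijective fun p : LatticeState N C × (Fin (C + 1) → Spin) × (Fin C → Spin) =>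
      p.1.addRow p.2.1 p.2.2 := by
  constructor
  · rintro ⟨⟨s, s'⟩, h, t⟩ ⟨⟨u, u'⟩, k, l⟩ hp
    simp only [addRow, Prod.mk.injEq, Fin.snoc_inj] at hp ⊢
    tauto
  · rintro ⟨s, s'⟩
    exact ⟨⟨⟨Fin.init s, Fin.init s'⟩, s (Fin.last _), s' (Fin.last _)⟩, by simp [addRow]⟩

theorem addRow_hasBoundary (s : LatticeState N C) (h : Fin (C + 1) → Spin) (t : Fin C → Spin)
    (l r : Spin) (bottom top : Fin C → Spin) :
    (s.addRow h t).HasBoundary (fun _ => l) (fun _ => r) bottom top ↔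
      (h 0 = l ∧ h (Fin.last C) = r) ∧ t = top ∧
        s.HasBoundary (fun _ => l) (fun _ => r) bottom (s.2 (Fin.last N)) := by
  have h0 : (Fin.snoc s.2 t : Fin (N + 2) → Fin C → Spin) 0 = s.2 0 :=
    Fin.snoc_castSucc (α := fun _ => Fin C → Spin) t s.2 0
  simp only [HasBoundary, hor, ver, addRow, Fin.forall_fin_succ', Fin.snoc_castSucc, Fin.snoc_last,
    h0, funext_iff]
  tauto

theorem weight_addRow (w : Fin (N + 1) → SixVertexWeights R) (s : LatticeState N C)
    (h : Fin (C + 1) → Spin) (t : Fin C → Spin) :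
    (s.addRow h t).weight w = s.weight (fun i => w i.castSucc) *
      ∏ j : Fin C, (w (Fin.last N)).vertexWeight (h j.castSucc) (t j) (h j.succ)
        (s.2 (Fin.last N) j) := by
  simp only [weight, hor, ver, addRow, Fin.prod_univ_castSucc, Fin.snoc_castSucc, Fin.snoc_last,
    Fin.succ_last, ← Fin.castSucc_succ]

end LatticeState

theorem partitionFunction_zero_rows {C : ℕ} (w : Fin 0 → SixVertexWeights R) (l r : Spin)
    (bottom top : Fin C → Spin) :
    partitionFunction w (fun _ => l) (fun _ => r) bottom top = if bottom = top then 1 else 0 := by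
  classical
  rw [partitionFunction, Finset.sum_filter]
  rw [Finset.sum_eq_single (⟨fun i => i.elim0, fun _ => top⟩ : LatticeState 0 C)]
  · simp [LatticeState.HasBoundary, LatticeState.weight, LatticeState.ver, funext_iff, eq_comm]
  · rintro ⟨s, s'⟩ - hs
    refine if_neg fun h => hs (Prod.ext (funext fun i => i.elim0) (funext fun i => funext fun j => ?_))
    rw [Subsingleton.elim (α := Fin 1) i (Fin.last 0)]
    exact h.2.2.2 j
  · simp

theorem partitionFunction_succ {N C : ℕ} (w : Fin (N + 1) → SixVertexWeights R) (l : Spin)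
    (bottom top : Fin C → Spin) :
    partitionFunction w (fun _ => l) (fun _ => .minus) bottom top =
      ∑ v, rowTransfer (w (Fin.last N)) l top v *
        partitionFunction (fun i => w i.castSucc) (fun _ => l) (fun _ => .minus) bottom v := by
  classical
  rw [partitionFunction, Finset.sum_filter,
    ← (Equiv.ofBijective _ LatticeState.addRow_bijective).sum_comp, Fintype.sum_prod_type]
  simp only [Equiv.ofBijective_apply, LatticeState.addRow_hasBoundary, LatticeState.weight_addRow,
    partitionFunction, Finset.sum_filter, Finset.mul_sum]
  rw [Finset.sum_comm (s := Finset.univ (α := Fin C → Spin))]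
  refine Finset.sum_congr rfl fun s _ => ?_
  rw [Fintype.sum_prod_type, Finset.sum_eq_single (s.2 (Fin.last N))]
  · simp only [rowTransfer, Finset.sum_mul]
    refine Finset.sum_congr rfl fun h _ => ?_
    rw [Finset.sum_eq_single top (by intro t _ ht; simp [ht]) (by simp)]
    by_cases h1 : h 0 = l ∧ h (Fin.last C) = .minus <;>
    by_cases h2 : s.HasBoundary (fun _ => l) (fun _ => .minus) bottom (s.2 (Fin.last N)) <;>
    simp [h1, h2, mul_comm]
  · intro v _ hv
    rw [if_neg, mul_zero]
    exact fun h => hv (funext fun j => (h.2.2.2 j).symm)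
  · simp

theorem prod_Iio_castSucc_last {N : ℕ} (f : Fin (N + 1) → Fin (N + 1) → R) :
    ∏ i, ∏ j ∈ Finset.Iio i, f i j =
      (∏ i : Fin N, ∏ j ∈ Finset.Iio i, f i.castSucc j.castSucc) *
        ∏ j : Fin N, f (Fin.last N) j.castSucc := by
  rw [Fin.prod_univ_castSucc]
  congr 1
  · refine Finset.prod_congr rfl fun i _ => ?_
    rw [Fin.prod_Iio_castSucc]
  · rw [Fin.Iio_last_eq_map, Finset.prod_map]
    rfl

/-- Free fermionic partition functions as alternants, up to the difference product. -/
theorem partitionFunction_mul_prod_sub {N C : ℕ} (w : Fin N → SixVertexWeights R)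
    (hff : ∀ i, (w i).FreeFermionic) (x : Fin N → R) (hx : ∀ i, (w i).b₂ = (w i).a₁ * x i)
    (top : Fin C → Spin) :
    partitionFunction w (fun _ => .plus) (fun _ => .minus) (fun _ => .plus) top *
        (∏ i, (w i).a₁ ^ N) * ∏ i, ∏ j ∈ Finset.Iio i, (x j - x i) =
      (∏ i, (w i).a₁ ^ C * (w i).c₂) *
        (∏ i, ∏ j ∈ Finset.Iio i, ((w j).a₁ * (w i).a₂ + (w i).b₁ * (w j).b₂)) *
        evalAlternant N x (spinWedge R top) := by
  induction N generalizing top with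
  | zero =>
    rw [partitionFunction_zero_rows]
    -- With no rows only the all-`plus` top survives, matching the projection onto degree 0.
    induction C with
    | zero => simp [evalAlternant, spinWedge, Subsingleton.elim _ top]
    | succ C ih =>
      obtain ⟨s, top, rfl⟩ : ∃ s t, top = Fin.cons s t := ⟨top 0, Fin.tail top, by simp⟩
      cases s with
      | plus =>
        rw [spinWedge_cons_plus]
        simpa [funext_iff, Fin.forall_fin_succ] using ih top
      | minus => simp [funext_iff, Fin.forall_fin_succ, spinWedge_cons_minus, evalAlternant,
          algebraMapInv]
  | succ N ih =>
    set a := (w (Fin.last N)).a₁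
    have key := congrArg (evalAlternant N (Fin.init x))
      (map_rowState (w (Fin.last N)) (hff _) (x (Fin.last N)) (hx _) top).1
    rw [map_smul, map_smul, evalAlternant_map, evalAlternant_map, ← evalAlternant_succ, rowState,
      map_sum, smul_eq_mul, smul_eq_mul] at key
    simp only [map_smul, smul_eq_mul] at key
    have ih' := fun v : Fin C → Spin =>
      ih (fun i => w i.castSucc) (fun i => hff _) (Fin.init x) (fun i => hx _) v
    -- Of the new powers of a₁, the old rows' extra factors clear the denominators of x_j in a₂ +
    -- b₁x_j; those of the top row serve the differences x_j - x_N and the factor a₁ in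
    -- `map_rowState`.
    have e1 : ∏ i, (w i).a₁ ^ (N + 1) =
        (∏ i : Fin N, (w i.castSucc).a₁ ^ N) * (∏ i : Fin N, (w i.castSucc).a₁) * (a * a ^ N) := by
      rw [Fin.prod_univ_castSucc, ← Finset.prod_mul_distrib]
      simp only [pow_succ, a, mul_comm]
    have e2 : a ^ N * ∏ j : Fin N, (x j.castSucc - x (Fin.last N)) =
        ∏ i, (Polynomial.C a * X - Polynomial.C (w (Fin.last N)).b₂).eval (Fin.init x i) := by
      rw [← Fin.prod_const, ← Finset.prod_mul_distrib]
      refine Finset.prod_congr rfl fun i _ => ?_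
      simp [hx, Fin.init, a, mul_sub]
    have e3 : ∏ j : Fin N, ((w j.castSucc).a₁ * (w (Fin.last N)).a₂ +
          (w (Fin.last N)).b₁ * (w j.castSucc).b₂) =
        (∏ i : Fin N, (w i.castSucc).a₁) * ∏ i : Fin N, (Polynomial.C (w (Fin.last N)).a₂ +
          Polynomial.C (w (Fin.last N)).b₁ * X).eval (Fin.init x i) := by
      rw [← Finset.prod_mul_distrib]
      refine Finset.prod_congr rfl fun i _ => ?_
      simp [hx, Fin.init]
      ring
    rw [partitionFunction_succ, prod_Iio_castSucc_last, prod_Iio_castSucc_last, e1, e3,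
      Fin.prod_univ_castSucc (f := fun i => (w i).a₁ ^ C * (w i).c₂)]
    set A := ∏ i : Fin N, (w i.castSucc).a₁ ^ N
    set B := ∏ i : Fin N, (w i.castSucc).a₁
    set V := ∏ i : Fin N, ∏ j ∈ Finset.Iio i, (x j.castSucc - x i.castSucc)
    set K := ∏ i : Fin N, ((w i.castSucc).a₁ ^ C * (w i.castSucc).c₂)
    set L := ∏ i : Fin N, ∏ j ∈ Finset.Iio i,
      ((w j.castSucc).a₁ * (w i.castSucc).a₂ + (w i.castSucc).b₁ * (w j.castSucc).b₂)
    have hsum : (∑ v, rowTransfer (w (Fin.last N)) .plus top v *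
          partitionFunction (fun i => w i.castSucc) (fun _ => .plus) (fun _ => .minus)
            (fun _ => .plus) v) * A * V =
        K * L * ∑ v, rowTransfer (w (Fin.last N)) .plus top v *
          evalAlternant N (Fin.init x) (spinWedge R v) := by
      rw [Finset.sum_mul, Finset.sum_mul, Finset.mul_sum]
      refine Finset.sum_congr rfl fun v _ => ?_
      have h : partitionFunction (fun i => w i.castSucc) (fun _ => .plus) (fun _ => .minus)
            (fun _ => .plus) v * A * V =
          K * L * evalAlternant N (Fin.init x) (spinWedge R v) := ih' v
      linear_combination rowTransfer (w (Fin.last N)) .plus top v * h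
    linear_combination (B * a * a ^ N * ∏ j : Fin N, (x j.castSucc - x (Fin.last N))) * hsum +
      K * L * B * key + (K * L * B * a * ∑ v, rowTransfer (w (Fin.last N)) .plus top v *
          evalAlternant N (Fin.init x) (spinWedge R v)) * e2

/-! ### Domain-wall boundary and Schur polynomials -/

theorem List.prod_map_ite_one {α A : Type*} [Monoid A] (p : α → Prop) [DecidablePred p] (f : α → A)
    (l : List α) : (l.map fun i => if p i then f i else 1).prod = ((l.filter p).map f).prod := by
  induction l with
  | nil => rfl
  | cons i l ih => by_cases h : p i <;> simp [h, ih]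

/-- The wedge runs through the columns from left to right, so the decreasing parts of `p` are read
backwards and no sign appears. -/
theorem spinWedge_boundarySpin {N C : ℕ} (p : Fin N → ℕ) (q : Fin N → Fin C) (hq : StrictMono q)
    (hpq : ∀ k, p k.rev = q k) :
    spinWedge R (boundarySpin p : Fin C → Spin) =
      ιMulti R N fun k => (X ^ ((q k).rev : ℕ) : R[X]) := by
  have hmem : ∀ j : Fin C, boundarySpin p j = .minus ↔ ∃ k, q k = j := by
    intro j
    have : (∃ k, p k = (j : ℕ)) ↔ ∃ k, q k = j := by
      rw [← Fin.revPerm.exists_congr_right]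
      simp [hpq, Fin.ext_iff]
    rw [← this]
    by_cases h : ∃ k, p k = (j : ℕ) <;> simp [boundarySpin, h]
  have hlist : (List.finRange C).filter (fun j => boundarySpin p j = .minus) = List.ofFn q := by
    refine List.Pairwise.eq_of_mem_iff (r := (· < ·))
      ((List.pairwise_lt_finRange C).filter _) ?_ fun j => ?_
    · exact List.pairwise_ofFn.2 fun i j h => hq h
    · simp [hmem, List.mem_ofFn]
  rw [spinWedge, List.ofFn_eq_map, List.prod_map_ite_one, hlist, ιMulti_apply, List.map_ofFn]
  rfl

theorem aeval_alternant {N : ℕ} (x : Fin N → R) (m : Fin N → ℕ) :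
    MvPolynomial.aeval x (alternant m) = (Matrix.of fun i j => x i ^ m j).det := by
  rw [alternant, AlgHom.map_det]
  congr 1
  ext i j
  simp

theorem aeval_alternant_rho {N : ℕ} (x : Fin N → R) :
    MvPolynomial.aeval x (alternant (shiftRho fun _ : Fin N => 0)) =
      ∏ i, ∏ j ∈ Finset.Iio i, (x j - x i) := by
  have h : (Matrix.of fun i j => x i ^ shiftRho (fun _ : Fin N => 0) j) =
      Matrix.projVandermonde (fun _ => 1) x := by
    ext i j
    simp [shiftRho, Matrix.projVandermonde_apply]
  rw [aeval_alternant, h, Matrix.det_projVandermonde,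
    Finset.prod_comm' (t' := Finset.univ) (s' := Finset.Iio) (by simp)]
  simp

section

variable {N M : ℕ} {lam : Fin N → ℕ}

theorem StrictAnti.shiftRho (hlam : Antitone lam) : StrictAnti (shiftRho lam) := by
  intro i j h
  have h1 := hlam h.le
  have h2 : (j.rev : ℕ) < i.rev := Fin.rev_lt_rev.2 h
  simp only [_root_.shiftRho]
  omega

theorem le_of_shiftRho_le (hlam : Antitone lam) (hM : ∀ k, shiftRho lam k ≤ M) : N ≤ M + 1 := by
  have h : Function.Injective fun k => (⟨shiftRho lam k, Nat.lt_succ_of_le (hM k)⟩ : Fin (M + 1)) :=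
    fun i j h => (StrictAnti.shiftRho hlam).injective (Fin.mk.inj h)
  simpa using Fintype.card_le_of_injective _ h

/-- Reflecting the columns, j ↦ M - j, complements the partition in the box. Bounding every part by
the largest one makes the truncated subtractions exact. -/
theorem shiftRho_boxComplement (hlam : Antitone lam) (hM : ∀ k, shiftRho lam k ≤ M) (k : Fin N) :
    shiftRho (boxComplement (M + 1 - N) lam) k = M - shiftRho lam k.rev := by
  have hk := k.isLt
  have h0 := hM ⟨0, by omega⟩
  have h1 : lam k.rev ≤ lam ⟨0, by omega⟩ := hlam (Fin.le_def.2 (Nat.zero_le _))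
  simp only [shiftRho, boxComplement, Fin.val_rev, Fin.rev_rev] at *
  omega

theorem evalAlternant_spinWedge_boundarySpin (hlam : Antitone lam) (hM : ∀ k, shiftRho lam k ≤ M)
    (x : Fin N → R) :
    evalAlternant N x (spinWedge R (boundarySpin (shiftRho lam) : Fin (M + 1) → Spin)) =
      MvPolynomial.aeval x (alternant (shiftRho (boxComplement (M + 1 - N) lam))) := by
  rw [spinWedge_boundarySpin _ (fun k => ⟨shiftRho lam k.rev, Nat.lt_succ_of_le (hM _)⟩)
      (fun i j h => StrictAnti.shiftRho hlam (Fin.rev_lt_rev.2 h)) (fun _ => rfl),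
    evalAlternant_ιMulti, aeval_alternant]
  congr 1
  ext i j
  simp [shiftRho_boxComplement hlam hM]

/-- The partition function in terms of Schur polynomials, when the spectral parameters are generic
over a domain. -/
theorem domainWallZ_mul_prod_of_injective [IsDomain R] (w : Fin N → SixVertexWeights R)
    (hff : ∀ i, (w i).FreeFermionic) (x : Fin N → R) (hx : ∀ i, (w i).b₂ = (w i).a₁ * x i)
    (hinj : Function.Injective x) (hlam : Antitone lam) (hM : ∀ k, shiftRho lam k ≤ M) :
    domainWallZ M w lam * ∏ i, (w i).a₁ ^ N =
      (∏ i, (w i).a₁ ^ (M + 1) * (w i).c₂) *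
        (∏ i, ∏ j ∈ Finset.Iio i, ((w j).a₁ * (w i).a₂ + (w i).b₁ * (w j).b₂)) *
        MvPolynomial.aeval x (schurPoly (boxComplement (M + 1 - N) lam)) := by
  have hV : ∏ i, ∏ j ∈ Finset.Iio i, (x j - x i) ≠ 0 :=
    Finset.prod_ne_zero_iff.2 fun i _ => Finset.prod_ne_zero_iff.2 fun j hj =>
      sub_ne_zero.2 fun h => (Finset.mem_Iio.1 hj).ne (hinj h)
  have h := partitionFunction_mul_prod_sub w hff x hx
    (boundarySpin (shiftRho lam) : Fin (M + 1) → Spin)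
  rw [evalAlternant_spinWedge_boundarySpin hlam hM, ← alternant_rho_mul_schurPoly, map_mul,
    aeval_alternant_rho] at h
  refine mul_right_cancel₀ hV ?_
  rw [domainWallZ, h]
  ring

end

/-! ### Deformation to distinct points -/

namespace SixVertexWeights

variable {S : Type*} [CommRing S]

/-- The image of the weights under a ring homomorphism. -/
def map (f : R →+* S) (w : SixVertexWeights R) : SixVertexWeights S :=
  ⟨f w.a₁, f w.a₂, f w.b₁, f w.b₂, f w.c₁, f w.c₂⟩

theorem vertexWeight_map (f : R →+* S) (w : SixVertexWeights R) (l t r b : Spin) :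
    (w.map f).vertexWeight l t r b = f (w.vertexWeight l t r b) := by
  cases l <;> cases t <;> cases r <;> cases b <;> simp [vertexWeight, map]

/-- A free fermionic deformation of the weights that shifts `b₂ / a₁` by `t`. -/
def deform (w : SixVertexWeights R) (t : R) : SixVertexWeights R :=
  ⟨w.a₁, w.a₂ - w.b₁ * t, w.b₁, w.b₂ + w.a₁ * t, w.c₁, w.c₂⟩

theorem FreeFermionic.map {w : SixVertexWeights R} (h : w.FreeFermionic) (f : R →+* S) :
    (w.map f).FreeFermionic := by
  simp only [FreeFermionic, SixVertexWeights.map, ← map_mul, ← map_add] at h ⊢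
  rw [h]

theorem FreeFermionic.deform {w : SixVertexWeights R} (h : w.FreeFermionic) (t : R) :
    (w.deform t).FreeFermionic := by
  simp only [FreeFermionic, SixVertexWeights.deform] at h ⊢
  linear_combination h

end SixVertexWeights

theorem domainWallZ_map {S : Type*} [CommRing S] (f : R →+* S) {N : ℕ} (M : ℕ)
    (w : Fin N → SixVertexWeights R) (lam : Fin N → ℕ) :
    domainWallZ M (fun i => (w i).map f) lam = f (domainWallZ M w lam) := by
  simp [domainWallZ, partitionFunction, LatticeState.weight, SixVertexWeights.vertexWeight_map]

theorem map_ringHom_aeval {S σ : Type*} [CommRing S] (f : R →+* S) (x : σ → R)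
    (P : MvPolynomial σ ℤ) :
    f (MvPolynomial.aeval x P) = MvPolynomial.aeval (fun i => f (x i)) P :=
  (MvPolynomial.comp_aeval_apply (f := x) f.toIntAlgHom P)

end FreeFermions

theorem mainTheorem8 {K : Type*} [Field K] (N M : ℕ) (w : Fin N → SixVertexWeights K)
    (hff : ∀ i, (w i).FreeFermionic) (ha : ∀ i, (w i).a₁ ≠ 0)
    (lam : Fin N → ℕ) (hlam : Antitone lam) (hM : ∀ k, shiftRho lam k ≤ M) :
    domainWallZ M w lam =
      (∏ i, (w i).a₁ ^ (M + 1 - N) * (w i).c₂) *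
      (∏ i, ∏ j ∈ Finset.Iio i, ((w j).a₁ * (w i).a₂ + (w i).b₁ * (w j).b₂)) *
      MvPolynomial.aeval (fun i => (w i).b₂ / (w i).a₁)
        (schurPoly (boxComplement (M + 1 - N) lam)) := by
  have hA : ∏ i, (w i).a₁ ^ N ≠ 0 := Finset.prod_ne_zero_iff.2 fun i _ => pow_ne_zero _ (ha i)
  -- A separate variable for each row makes the ratios b₂ / a₁ distinct, even when they coincide in
  -- K or K is finite.
  let W : Fin N → SixVertexWeights (MvPolynomial (Fin N) K) := fun i =>
    ((w i).map MvPolynomial.C).deform (MvPolynomial.X i)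
  let x : Fin N → MvPolynomial (Fin N) K := fun i =>
    MvPolynomial.C ((w i).b₂ / (w i).a₁) + MvPolynomial.X i
  have hx : ∀ i, (W i).b₂ = (W i).a₁ * x i := by
    intro i
    simp only [W, x, SixVertexWeights.deform, SixVertexWeights.map, mul_add, ← map_mul,
      mul_div_cancel₀ _ (ha i)]
  have hinj : Function.Injective x := by
    intro i j h
    by_contra hij
    have h0 : (0 : Fin N →₀ ℕ) ≠ Finsupp.single i 1 := (Finsupp.single_ne_zero.2 one_ne_zero).symm
    have := congrArg (MvPolynomial.coeff (Finsupp.single i 1)) h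
    simp [x, MvPolynomial.coeff_C, MvPolynomial.coeff_X, Finsupp.single_left_inj, Ne.symm hij,
      h0] at this
  let f : MvPolynomial (Fin N) K →+* K := MvPolynomial.eval fun _ => 0
  have hW : ∀ i, (W i).map f = w i := by
    intro i
    simp [W, f, SixVertexWeights.deform, SixVertexWeights.map]
  have hfx : (fun i => f (x i)) = fun i => (w i).b₂ / (w i).a₁ := by
    funext i
    simp [f, x]
  have key := congrArg f (domainWallZ_mul_prod_of_injective W
    (fun i => ((hff i).map _).deform _) x hx hinj hlam hM)
  have h1 : ∀ i, f (W i).a₁ = (w i).a₁ := fun i => congrArg SixVertexWeights.a₁ (hW i)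
  have h2 : ∀ i, f (W i).a₂ = (w i).a₂ := fun i => congrArg SixVertexWeights.a₂ (hW i)
  have h3 : ∀ i, f (W i).b₁ = (w i).b₁ := fun i => congrArg SixVertexWeights.b₁ (hW i)
  have h4 : ∀ i, f (W i).b₂ = (w i).b₂ := fun i => congrArg SixVertexWeights.b₂ (hW i)
  have h5 : ∀ i, f (W i).c₂ = (w i).c₂ := fun i => congrArg SixVertexWeights.c₂ (hW i)
  simp only [map_mul, map_ringHom_aeval, ← domainWallZ_map, map_prod, map_pow, map_add, hW, h1, h2,
    h3, h4, h5, hfx] at key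
  have hp : ∏ i, (w i).a₁ ^ (M + 1) * (w i).c₂ =
      (∏ i, (w i).a₁ ^ (M + 1 - N) * (w i).c₂) * ∏ i, (w i).a₁ ^ N := by
    rw [← Finset.prod_mul_distrib]
    refine Finset.prod_congr rfl fun i _ => ?_
    -- The exponent M + 1 - N is exact because the N distinct parts of λ + ρ lie among M + 1
    -- columns.
    rw [mul_right_comm, ← pow_add, Nat.sub_add_cancel (le_of_shiftRho_le hlam hM)]
  refine mul_right_cancel₀ hA ?_
  rw [key, hp]
  ring
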